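/- Theorem 3 (Regularization of Polynomial Factorization). There is an absolute constant $\alpha>0$ for which the following holds. Let $k\ge 0$, let $\mathcal U_0=\mathbb C$, and let $\mathcal U_1,\dots,\mathcal U_k$ and $\mathcal P$ be finite-dimensional vector spaces of complex polynomials (in any set of variables), each with a norm that comes from a Hermitian inner product (for example the 2-norm of the coefficient vector); equip $\mathcal U_0\times\cdots\times\mathcal U_k$ with the norm $\big(|u_0|^2+\|u_1\|^2+\cdots+\|u_k\|^2\big)^{1/2}$ and linear maps with the operator norm. Let $\ell_1,\dots,\ell_k$ be positive integers, and let $p=\hat u_0\hat u_1^{\ell_1}\cdots\hat u_k^{\ell_k}\in\mathcal P$ be an irreducible factorization: $\hat u_0\in\mathbb C\setminus\{0\}$, and $\hat u_1,\dots,\hat u_k$ are irreducible polynomials, no two of which differ by a constant factor. Assume that $\hat u_j$ lies in $\mathcal U_j$ and that $\mathcal U_j$ is a proper hosting space of $\hat u_j$, i.e. if $s$ is a polynomial with $s\hat u_j\in\mathcal U_j$ then $s$ is constant ($j=1,\dots,k$; this is automatic for $j=0$). Assume that $\mathcal P$ contains all products $u_0u_1^{\ell_1}\cdots u_k^{\ell_k}$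 with $u_j\in\mathcal U_j$. For $q\in\mathcal P$ put $$\mathbf f(u_0,\dots,u_k,q)=u_0u_1^{\ell_1}\cdots u_k^{\ell_k}-q,$$ let $\mathbf f_{u_0\cdots u_k}$ be its Jacobian with respect to $(u_0,\dots,u_k)$, and set $r=\dim(\mathcal U_0\times\cdots\times\mathcal U_k)-k$. For a linear map $A$ let $A_{\text{rank-}r}$ be the map of rank $r$ at the smallest Frobenius distance to $A$, and $A_{\text{rank-}r}^\dagger$ its Moore--Penrose inverse. Then there are $\delta,\varepsilon,C,M>0$, depending only on these data, such that for every $\tilde p\in\mathcal P$ with $\|\tilde p-p\|<\varepsilon$ and every initial iterate $\mathbf u^{(0)}\in\mathcal U_0\times\cdots\times\mathcal U_k$ with $\|\mathbf u^{(0)}-(\hat u_0,\dots,\hat u_k)\|<\delta$, the rank-$r$ Newton iteration $$\mathbf u^{(j+1)}=\mathbf u^{(j)}-\mathbf f_{u_0\cdots u_k}(\mathbf u^{(j)},\tilde p)_{\text{rank-}r}^\dagger\,\mathbf f(\mathbf u^{(j)},\tilde p),\qquad j=0,1,\dots$$ is well defined (the rank-$r$ projection of the Jacobian exists and is unique at every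 iterate) and converges to some $\tilde{\mathbf u}\in\mathcal U_0\times\cdots\times\mathcal U_k$ that satisfies $$\|\tilde{\mathbf u}-\check{\mathbf u}\|\le\alpha\,\big\|\mathbf f_{u_0\cdots u_k}(\hat u_0,\dots,\hat u_k,p)_{\text{rank-}r}^\dagger\big\|\,\|\tilde p-p\|+C\|\tilde p-p\|^2$$ for some exact factor array $\check{\mathbf u}$ of $p$ in the set $\{(t_0\hat u_0,t_1\hat u_1,\dots,t_k\hat u_k): t_1,\dots,t_k\in\mathbb C\setminus\{0\},\ t_0=t_1^{-\ell_1}\cdots t_k^{-\ell_k}\}$. If $\tilde p=p$, the convergence is quadratic: $\|\mathbf u^{(j+1)}-\tilde{\mathbf u}\|\le M\|\mathbf u^{(j)}-\tilde{\mathbf u}\|^2$ for all $j\ge 0$. -/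

import Mathlib

/-! ### Moore-Penrose inverse and rank-`r` projection of a linear map -/

section LowRank

variable {E F : Type*} [NormedAddCommGroup E] [InnerProductSpace ℂ E] [FiniteDimensional ℂ E]
  [NormedAddCommGroup F] [InnerProductSpace ℂ F] [FiniteDimensional ℂ F]

/-- The four Penrose conditions: `B` is the Moore-Penrose inverse of `A`. -/
structure IsMoorePenrose (A : E →L[ℂ] F) (B : F →L[ℂ] E) : Prop where
  mul_inv_mul : A ∘L B ∘L A = A
  inv_mul_inv : B ∘L A ∘L B = B
  symm_left : ((A ∘L B : F →L[ℂ] F) : F →ₗ[ℂ] F).IsSymmetric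
  symm_right : ((B ∘L A : E →L[ℂ] E) : E →ₗ[ℂ] E).IsSymmetric

theorem exists_isMoorePenrose (A : E →L[ℂ] F) : ∃ B : F →L[ℂ] E, IsMoorePenrose A B := by
  let K : Submodule ℂ E := LinearMap.ker (A : E →ₗ[ℂ] F)
  let R : Submodule ℂ F := LinearMap.range (A : E →ₗ[ℂ] F)
  have hc : IsCompl Kᗮ K := (Submodule.isCompl_orthogonal (K := K)).symm
  let e : Kᗮ ≃ₗ[ℂ] R := LinearMap.kerComplementEquivRange (A : E →ₗ[ℂ] F) hc
  let B : F →L[ℂ] E := LinearMap.toContinuousLinearMap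
    (Kᗮ.subtype ∘ₗ e.symm.toLinearMap ∘ₗ (R.orthogonalProjectionOnto : F →ₗ[ℂ] R))
  have he : ∀ y : R, A (e.symm y : E) = y := fun y => by
    have h := congrArg Subtype.val (e.apply_symm_apply y)
    exact h
  have hAB : ∀ y, A (B y) = R.starProjection y := fun y => he _
  have hBA : ∀ x, B (A x) = Kᗮ.starProjection x := fun x => by
    have h1 : B (A x) ∈ Kᗮ := (e.symm _).2
    have h2 : A (B (A x)) = A x := by
      rw [hAB]
      exact Submodule.starProjection_eq_self_iff.2 ⟨x, rfl⟩
    refine (Submodule.eq_starProjection_of_mem_of_inner_eq_zero h1 fun w hw => ?_).symm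
    have h3 : x - B (A x) ∈ K := by
      change A (x - B (A x)) = 0
      rw [map_sub, h2, sub_self]
    exact (Submodule.mem_orthogonal K w).1 hw _ h3
  refine ⟨B, ?_, ?_, ?_, ?_⟩
  · ext x
    change A (B (A x)) = A x
    rw [hAB]
    exact Submodule.starProjection_eq_self_iff.2 ⟨x, rfl⟩
  · ext y
    change B (A (B y)) = B y
    rw [hBA]
    exact Submodule.starProjection_eq_self_iff.2 (e.symm _).2
  · have h : (A ∘L B) = R.starProjection := by ext y; exact hAB y
    rw [h]
    exact R.starProjection_isSymmetric
  · have h : (B ∘L A) = Kᗮ.starProjection := by ext x; exact hBA x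
    rw [h]
    exact Kᗮ.starProjection_isSymmetric

/-- The Moore-Penrose inverse. -/
noncomputable def moorePenrose (A : E →L[ℂ] F) : F →L[ℂ] E :=
  (exists_isMoorePenrose A).choose

/-- The squared Frobenius norm of a linear map between Hermitian spaces, i.e. of its matrix in
orthonormal bases (it does not depend on the bases). -/
noncomputable def frobeniusSq (A : E →L[ℂ] F) : ℝ :=
  ∑ i, ‖A (stdOrthonormalBasis ℂ E i)‖ ^ 2

/-- The rank of a linear map. -/
noncomputable def mapRank (A : E →L[ℂ] F) : ℕ :=
  Module.finrank ℂ (LinearMap.range (A : E →ₗ[ℂ] F))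

/-- `B` has rank `r` and is at the smallest Frobenius distance to `A` among the maps of
rank `r`. -/
def IsRankProjection (r : ℕ) (A B : E →L[ℂ] F) : Prop :=
  mapRank B = r ∧ ∀ C : E →L[ℂ] F, mapRank C = r → frobeniusSq (B - A) ≤ frobeniusSq (C - A)

open Classical in
/-- The rank-`r` projection of `A` (the value `0` is used only if no closest map of rank `r`
exists). -/
noncomputable def rankProjection (r : ℕ) (A : E →L[ℂ] F) : E →L[ℂ] F :=
  if h : ∃ B, IsRankProjection r A B then h.choose else 0

/-- The rank-`r` Newton iteration `x ↦ x - (f'(x)_{rank-r})^† f(x)` started at `x₀`. -/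
noncomputable def rankNewton (r : ℕ) (f : E → F) (x₀ : E) : ℕ → E
  | 0 => x₀
  | j + 1 => rankNewton r f x₀ j -
      moorePenrose (rankProjection r (fderiv ℂ f (rankNewton r f x₀ j)))
        (f (rankNewton r f x₀ j))

end LowRank

/-! ### The factorization map

A vector space of polynomials with a Hermitian norm is a Hermitian space `V` together with an
injective linear map `V →ₗ[ℂ] MvPolynomial σ ℂ`, through which the elements of `V` are read as
polynomials. -/

section Factorization

variable {σ : Type*} {k : ℕ} {V : Fin k → Type*}
  [∀ j, NormedAddCommGroup (V j)] [∀ j, InnerProductSpace ℂ (V j)]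
  {W : Type*} [NormedAddCommGroup W] [InnerProductSpace ℂ W]

/-- The product `ℂ × V₁ × ⋯ × V_k` with the norm `(|u₀|² + ‖u₁‖² + ⋯ + ‖u_k‖²)^(1/2)`. -/
abbrev FactorSpace {k : ℕ} (V : Fin k → Type*) : Type _ := WithLp 2 (ℂ × PiLp 2 V)

/-- The polynomial `u₀ u₁^{ℓ₁} ⋯ u_k^{ℓ_k}`. -/
noncomputable def factorProduct (ι : ∀ j, V j →ₗ[ℂ] MvPolynomial σ ℂ) (ℓ : Fin k → ℕ)
    (u : FactorSpace V) : MvPolynomial σ ℂ :=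
  MvPolynomial.C u.fst * ∏ j, ι j (u.snd j) ^ ℓ j

/-- The map `(u₀, …, u_k, q) ↦ u₀ u₁^{ℓ₁} ⋯ u_k^{ℓ_k} - q` into the space `W` of polynomials,
which contains all these products. -/
noncomputable def facMap (ι : ∀ j, V j →ₗ[ℂ] MvPolynomial σ ℂ) (ℓ : Fin k → ℕ)
    (κ : W →ₗ[ℂ] MvPolynomial σ ℂ) (hκ : Function.Injective κ)
    (hW : ∀ u : FactorSpace V, factorProduct ι ℓ u ∈ LinearMap.range κ)
    (u : FactorSpace V) (q : W) : W :=
  (LinearEquiv.ofInjective κ hκ).symm ⟨factorProduct ι ℓ u, hW u⟩ - q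

/-- `p = u₀ u₁^{ℓ₁} ⋯ u_k^{ℓ_k}` is an irreducible factorization: `u₀` is a nonzero constant,
`u₁, …, u_k` are irreducible polynomials, no two of which are associates, and the exponents are
positive. -/
structure IsIrreducibleFactorization (ι : ∀ j, V j →ₗ[ℂ] MvPolynomial σ ℂ) (ℓ : Fin k → ℕ)
    (u : FactorSpace V) (p : MvPolynomial σ ℂ) : Prop where
  eq_prod : p = factorProduct ι ℓ u
  const_ne_zero : u.fst ≠ 0
  irreducible : ∀ j, Irreducible (ι j (u.snd j))
  not_associated : ∀ i j, i ≠ j → ¬ Associated (ι i (u.snd i)) (ι j (u.snd j))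
  exponent_pos : ∀ j, 0 < ℓ j

/-- A space of polynomials is a proper hosting space of its member `v` if it contains no
multiple `s * v` with a nonconstant polynomial `s`. -/
def IsProperHost {V₀ : Type*} [AddCommGroup V₀] [Module ℂ V₀]
    (ι₀ : V₀ →ₗ[ℂ] MvPolynomial σ ℂ) (v : V₀) : Prop :=
  ∀ s : MvPolynomial σ ℂ, s * ι₀ v ∈ LinearMap.range ι₀ → ∃ c : ℂ, s = MvPolynomial.C c

/-- The set of the exact factor arrays `(t₀ u₀, t₁ u₁, …, t_k u_k)` with nonzero `t₁, …, t_k` and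
`t₀ = t₁^{-ℓ₁} ⋯ t_k^{-ℓ_k}`. -/
def factorArrays (ℓ : Fin k → ℕ) (u : FactorSpace V) : Set (FactorSpace V) :=
  {x | ∃ t : Fin k → ℂ, (∀ j, t j ≠ 0) ∧
    x.fst = (∏ j, (t j ^ ℓ j)⁻¹) * u.fst ∧ ∀ j, x.snd j = t j • u.snd j}

end Factorization

/-! Rescaling the factors by nonzero constants whose combined effect on the product cancels moves an
array along a `k`-dimensional orbit on which the product is constant. At every array with nonzero
factors the tangent space of this orbit lies in the kernel of the Jacobian, so the rank there is at
most `r` (`mapRank_fderiv_le`). At the exact factorization the kernel is no larger: irreducibility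
forces each `û_j` to divide the `j`-th component of a kernel vector, and proper hosting makes the
quotient constant (`ker_fderiv_eq_range_scalingTangent`). Since rank cannot drop under small
perturbations, the Jacobian has rank exactly `r` near the factorization. There the rank projection
does nothing, the Moore-Penrose inverses are uniformly bounded (`exists_norm_moorePenrose_le`), and
the iteration is a Gauss-Newton iteration of constant rank.

After a Gauss-Newton step the new residual is a part orthogonal to the range of the old Jacobian
plus a Taylor remainder. The new Moore-Penrose inverse nearly annihilates the first part, so on a
small ball each step is at most half the previous one, and the iterates converge to a point `w`
whose residual is orthogonal to the range of the Jacobian at `w`.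

For the error bound, `w` is compared with a point `g s` of the orbit such that `w - g s` is
orthogonal to the kernel at the exact factorization (`eventually_exists_sub_mem_orthogonal`). On
that complement the Jacobian is inverted by its Moore-Penrose inverse, and absorbing the nonlinear
terms costs a factor 2. With exact data this bound puts `w` on the orbit, the residual at `w`
vanishes, and the step estimate becomes quadratic. -/

set_option linter.unusedSectionVars false

/-! ### Moore-Penrose inverses and their stability at constant rank. -/

section LowRankFacts

variable {E F : Type*} [NormedAddCommGroup E] [InnerProductSpace ℂ E] [FiniteDimensional ℂ E]
  [NormedAddCommGroup F] [InnerProductSpace ℂ F] [FiniteDimensional ℂ F]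

theorem frobeniusSq_zero : frobeniusSq (0 : E →L[ℂ] F) = 0 := by
  simp [frobeniusSq]

theorem eq_zero_of_frobeniusSq_nonpos {A : E →L[ℂ] F} (h : frobeniusSq A ≤ 0) : A = 0 := by
  have h0 : frobeniusSq A = 0 := le_antisymm h (Finset.sum_nonneg fun i _ => by positivity)
  rw [frobeniusSq, Finset.sum_eq_zero_iff_of_nonneg fun i _ => by positivity] at h0
  have h1 : (A : E →ₗ[ℂ] F) = 0 := (stdOrthonormalBasis ℂ E).toBasis.ext fun i => by
    simpa using h0 i (Finset.mem_univ i)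
  ext x
  exact LinearMap.congr_fun h1 x

theorem isRankProjection_self {r : ℕ} {A : E →L[ℂ] F} (h : mapRank A = r) :
    IsRankProjection r A A :=
  ⟨h, fun C _ => by
    rw [sub_self, frobeniusSq_zero]
    exact Finset.sum_nonneg fun i _ => by positivity⟩

theorem IsRankProjection.eq_of_mapRank {r : ℕ} {A B : E →L[ℂ] F} (hB : IsRankProjection r A B)
    (h : mapRank A = r) : B = A := by
  have h1 := hB.2 A h
  rw [sub_self, frobeniusSq_zero] at h1
  exact sub_eq_zero.1 (eq_zero_of_frobeniusSq_nonpos h1)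

theorem existsUnique_isRankProjection {r : ℕ} {A : E →L[ℂ] F} (h : mapRank A = r) :
    ∃! B, IsRankProjection r A B :=
  ⟨A, isRankProjection_self h, fun _ hB => hB.eq_of_mapRank h⟩

theorem rankProjection_eq_self {r : ℕ} {A : E →L[ℂ] F} (h : mapRank A = r) :
    rankProjection r A = A := by
  have hex : ∃ B, IsRankProjection r A B := ⟨A, isRankProjection_self h⟩
  rw [rankProjection, dif_pos hex]
  exact hex.choose_spec.eq_of_mapRank h

theorem moorePenrose_spec (A : E →L[ℂ] F) : IsMoorePenrose A (moorePenrose A) :=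
  (exists_isMoorePenrose A).choose_spec

theorem map_moorePenrose_map (A : E →L[ℂ] F) (x : E) : A (moorePenrose A (A x)) = A x :=
  congrArg (fun T : E →L[ℂ] F => T x) (moorePenrose_spec A).mul_inv_mul

theorem moorePenrose_map_moorePenrose (A : E →L[ℂ] F) (y : F) :
    moorePenrose A (A (moorePenrose A y)) = moorePenrose A y :=
  congrArg (fun T : F →L[ℂ] E => T y) (moorePenrose_spec A).inv_mul_inv

theorem inner_map_moorePenrose (A : E →L[ℂ] F) (y z : F) :
    inner ℂ (A (moorePenrose A y)) z = inner ℂ y (A (moorePenrose A z)) :=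
  (moorePenrose_spec A).symm_left y z

theorem inner_moorePenrose_map (A : E →L[ℂ] F) (x z : E) :
    inner ℂ (moorePenrose A (A x)) z = inner ℂ x (moorePenrose A (A z)) :=
  (moorePenrose_spec A).symm_right x z

theorem moorePenrose_mem_orthogonal (A : E →L[ℂ] F) (y : F) :
    moorePenrose A y ∈ (LinearMap.ker (A : E →ₗ[ℂ] F))ᗮ := by
  rw [Submodule.mem_orthogonal']
  intro z hz
  have hz' : A z = 0 := hz
  rw [← moorePenrose_map_moorePenrose, inner_moorePenrose_map, hz', map_zero, inner_zero_right]

/-- Both sides lie in the orthogonal complement of the kernel and have the same image, so their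
difference is orthogonal to itself. -/
theorem moorePenrose_map_of_mem_orthogonal (A : E →L[ℂ] F) {x : E}
    (hx : x ∈ (LinearMap.ker (A : E →ₗ[ℂ] F))ᗮ) : moorePenrose A (A x) = x := by
  have h1 : moorePenrose A (A x) - x ∈ (LinearMap.ker (A : E →ₗ[ℂ] F))ᗮ :=
    Submodule.sub_mem _ (moorePenrose_mem_orthogonal A _) hx
  have h2 : moorePenrose A (A x) - x ∈ LinearMap.ker (A : E →ₗ[ℂ] F) := by
    change A _ = 0
    rw [map_sub, map_moorePenrose_map, sub_self]
  exact sub_eq_zero.1 (inner_self_eq_zero.1 ((Submodule.mem_orthogonal _ _).1 h1 _ h2))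

theorem inner_map_sub_map_moorePenrose (A : E →L[ℂ] F) (x : E) (y : F) :
    inner ℂ (A x) (y - A (moorePenrose A y)) = 0 := by
  rw [inner_sub_right, ← inner_map_moorePenrose, map_moorePenrose_map, sub_self]

theorem norm_map_moorePenrose_sq (A : E →L[ℂ] F) (y : F) :
    ((‖A (moorePenrose A y)‖ ^ 2 : ℝ) : ℂ) = inner ℂ (A (moorePenrose A y)) y := by
  have h := inner_map_sub_map_moorePenrose A (moorePenrose A y) y
  rw [inner_sub_right, sub_eq_zero, inner_self_eq_norm_sq_to_K] at h
  rw [h]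
  simp

theorem norm_map_moorePenrose_le (A : E →L[ℂ] F) (y : F) : ‖A (moorePenrose A y)‖ ≤ ‖y‖ := by
  have h := congrArg norm (norm_map_moorePenrose_sq A y)
  rw [Complex.norm_real, Real.norm_of_nonneg (by positivity)] at h
  have h1 := norm_inner_le_norm (𝕜 := ℂ) (A (moorePenrose A y)) y
  rw [← h] at h1
  by_contra! hlt
  nlinarith [norm_nonneg (A (moorePenrose A y)), norm_nonneg y]

theorem norm_sub_map_moorePenrose_le (A : E →L[ℂ] F) (y : F) :
    ‖y - A (moorePenrose A y)‖ ≤ ‖y‖ := by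
  have h := norm_add_sq_eq_norm_sq_add_norm_sq_of_inner_eq_zero (𝕜 := ℂ) _ _
    (inner_map_sub_map_moorePenrose A (moorePenrose A y) y)
  rw [add_sub_cancel] at h
  nlinarith [norm_nonneg (y - A (moorePenrose A y)), norm_nonneg y,
    norm_nonneg (A (moorePenrose A y))]

/-- The part of `y` orthogonal to the range of `A₁` is almost annihilated by the Moore-Penrose
inverse of a map `A₂` close to `A₁`. -/
theorem norm_moorePenrose_sub_le {A₁ A₂ : E →L[ℂ] F} {b : ℝ}
    (h₂ : ∀ y, ‖moorePenrose A₂ y‖ ≤ b * ‖y‖) (y : F) :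
    ‖moorePenrose A₂ (y - A₁ (moorePenrose A₁ y))‖ ≤ b ^ 2 * ‖A₂ - A₁‖ * ‖y‖ := by
  set z := y - A₁ (moorePenrose A₁ y) with hz
  set x := moorePenrose A₂ z with hx
  -- `A₂ x` is the projection of `z` onto the range of `A₂`, while `A₁ x` is orthogonal to `z`; only
  -- `A₂ - A₁` contributes.
  have h1 : ‖A₂ x‖ ^ 2 ≤ ‖A₂ - A₁‖ * ‖x‖ * ‖z‖ := by
    have h := congrArg norm (norm_map_moorePenrose_sq A₂ z)
    rw [Complex.norm_real, Real.norm_of_nonneg (by positivity), ← hx] at h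
    have h3 : inner ℂ (A₂ x) z = inner ℂ ((A₂ - A₁) x) z := by
      rw [sub_apply, inner_sub_left, hz, inner_map_sub_map_moorePenrose A₁ x y,
        sub_zero]
    rw [h, h3]
    exact (norm_inner_le_norm _ _).trans
      (mul_le_mul_of_nonneg_right ((A₂ - A₁).le_opNorm x) (norm_nonneg z))
  have h2 : ‖x‖ ≤ b * ‖A₂ x‖ := by
    have h := h₂ (A₂ x)
    rwa [hx, moorePenrose_map_moorePenrose] at h
  have h3 : ‖z‖ ≤ ‖y‖ := norm_sub_map_moorePenrose_le A₁ y
  rcases (norm_nonneg x).eq_or_lt with h0 | h0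
  · rw [← h0]; positivity
  · have h4 : ‖x‖ ^ 2 ≤ b ^ 2 * (‖A₂ - A₁‖ * ‖x‖ * ‖z‖) := by
      calc ‖x‖ ^ 2 ≤ (b * ‖A₂ x‖) ^ 2 := by gcongr
        _ = b ^ 2 * ‖A₂ x‖ ^ 2 := by ring
        _ ≤ _ := by gcongr
    have h5 : ‖x‖ ≤ b ^ 2 * ‖A₂ - A₁‖ * ‖z‖ := by
      refine le_of_mul_le_mul_right ?_ h0
      calc ‖x‖ * ‖x‖ = ‖x‖ ^ 2 := by ring
        _ ≤ _ := h4
        _ = _ := by ring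
    exact h5.trans (by gcongr)

theorem finrank_ker_orthogonal (A : E →L[ℂ] F) :
    Module.finrank ℂ (LinearMap.ker (A : E →ₗ[ℂ] F))ᗮ = mapRank A := by
  have h1 := Submodule.finrank_add_finrank_orthogonal (LinearMap.ker (A : E →ₗ[ℂ] F))
  have h2 := LinearMap.finrank_range_add_finrank_ker (A : E →ₗ[ℂ] F)
  rw [mapRank]
  omega

/-- Near a map of rank `r`, the maps of rank at most `r` have rank `r`, and their Moore-Penrose
inverses are uniformly bounded. -/
theorem exists_norm_moorePenrose_le (A₀ : E →L[ℂ] F) :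
    ∃ b > 0, ∃ η > 0, ∀ A : E →L[ℂ] F, ‖A - A₀‖ ≤ η → mapRank A ≤ mapRank A₀ →
      mapRank A = mapRank A₀ ∧ ∀ y, ‖moorePenrose A y‖ ≤ b * ‖y‖ := by
  set β := ‖moorePenrose A₀‖ + 1 with hβ
  have hβ0 : 0 < β := by positivity
  refine ⟨2 * β, by positivity, 1 / (2 * β), by positivity, fun A hA hr => ?_⟩
  set N := (LinearMap.ker (A₀ : E →ₗ[ℂ] F))ᗮ with hN
  -- `A₀` is bounded below by `1 / β` on `N`, and a perturbation of size `1 / (2 * β)` costs at most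
  -- half of that. Hence `A` is injective on `N`, and its rank cannot drop.
  have hlow : ∀ x ∈ N, ‖x‖ ≤ 2 * β * ‖A x‖ := fun x hx => by
    have h1 : ‖x‖ ≤ β * ‖A₀ x‖ := by
      conv_lhs => rw [← moorePenrose_map_of_mem_orthogonal A₀ hx]
      exact ((moorePenrose A₀).le_opNorm _).trans (by gcongr; linarith)
    have h2 : ‖A₀ x‖ ≤ ‖A x‖ + 1 / (2 * β) * ‖x‖ := by
      have h3 : A₀ x = A x - (A - A₀) x := by simp
      rw [h3]
      exact (norm_sub_le _ _).trans (add_le_add le_rfl ((A - A₀).le_of_opNorm_le hA x))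
    have h4 : ‖x‖ ≤ β * ‖A x‖ + 1 / 2 * ‖x‖ := by
      calc ‖x‖ ≤ β * (‖A x‖ + 1 / (2 * β) * ‖x‖) := h1.trans (by gcongr)
        _ = _ := by field_simp
    linarith
  let T : N →ₗ[ℂ] F := (A : E →ₗ[ℂ] F) ∘ₗ N.subtype
  have hT : Function.Injective T := by
    rw [injective_iff_map_eq_zero]
    intro x hx
    have h1 := hlow x x.2
    have h2 : A (x : E) = 0 := hx
    rw [h2, norm_zero, mul_zero] at h1
    exact Subtype.ext (norm_le_zero_iff.1 h1)
  have hle : LinearMap.range T ≤ LinearMap.range (A : E →ₗ[ℂ] F) := by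
    rintro _ ⟨x, rfl⟩
    exact ⟨x, rfl⟩
  have hTr : Module.finrank ℂ (LinearMap.range T) = mapRank A₀ := by
    rw [LinearMap.finrank_range_of_inj hT, hN, finrank_ker_orthogonal]
  have hrank : mapRank A = mapRank A₀ := by
    refine le_antisymm hr ?_
    rw [← hTr]
    exact Submodule.finrank_mono hle
  have heq : LinearMap.range T = LinearMap.range (A : E →ₗ[ℂ] F) :=
    Submodule.eq_of_le_of_finrank_eq hle (hTr.trans hrank.symm)
  refine ⟨hrank, fun y => ?_⟩
  set x := moorePenrose A y with hx
  -- By equality of ranks `A x` also has a preimage in `N`, where the lower bound applies; `x`,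
  -- being orthogonal to the kernel of `A`, is the shortest preimage.
  obtain ⟨x', hx'⟩ : A x ∈ LinearMap.range T := by
    rw [heq]
    exact ⟨x, rfl⟩
  have hx'A : A (x' : E) = A x := hx'
  have hBx : moorePenrose A (A x') = x := by
    rw [hx'A, hx, moorePenrose_map_moorePenrose]
  have horth : inner ℂ x ((x' : E) - x) = 0 := by
    refine (Submodule.mem_orthogonal' _ _).1 (moorePenrose_mem_orthogonal A y) _ ?_
    change A _ = 0
    rw [map_sub, hx'A, sub_self]
  have h1 := norm_add_sq_eq_norm_sq_add_norm_sq_of_inner_eq_zero (𝕜 := ℂ) _ _ horth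
  rw [add_sub_cancel] at h1
  have h2 : ‖x‖ ≤ ‖(x' : E)‖ := by
    nlinarith [norm_nonneg x, norm_nonneg (x' : E), norm_nonneg ((x' : E) - x)]
  calc ‖x‖ ≤ ‖(x' : E)‖ := h2
    _ ≤ 2 * β * ‖A x'‖ := hlow _ x'.2
    _ = 2 * β * ‖A x‖ := by rw [hx'A]
    _ ≤ 2 * β * ‖y‖ := by gcongr; exact norm_map_moorePenrose_le A y

end LowRankFacts

open Filter Topology

/-! ### Convergence of the Newton iteration at constant rank. -/

section RankNewton

variable {E F : Type*} [NormedAddCommGroup E] [InnerProductSpace ℂ E] [FiniteDimensional ℂ E]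
  [NormedAddCommGroup F] [InnerProductSpace ℂ F] [FiniteDimensional ℂ F]

/-- The estimates that hold on the ball of radius `ρ` around `x` when `f'` has locally constant
rank. -/
structure RankNewtonBounds (f : E → F) (x : E) (ρ b L : ℝ) : Prop where
  rank_eq : ∀ u, ‖u - x‖ < ρ → mapRank (fderiv ℂ f u) = mapRank (fderiv ℂ f x)
  moorePenrose_le : ∀ u, ‖u - x‖ < ρ → ∀ y, ‖moorePenrose (fderiv ℂ f u) y‖ ≤ b * ‖y‖
  fderiv_lipschitz : ∀ u v, ‖u - x‖ < ρ → ‖v - x‖ < ρ →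
    ‖fderiv ℂ f v - fderiv ℂ f u‖ ≤ L * ‖v - u‖
  lipschitz : ∀ u v, ‖u - x‖ < ρ → ‖v - x‖ < ρ → ‖f v - f u‖ ≤ L * ‖v - u‖
  taylor : ∀ u v, ‖u - x‖ < ρ → ‖v - x‖ < ρ →
    ‖f v - f u - fderiv ℂ f u (v - u)‖ ≤ L * ‖v - u‖ ^ 2

theorem RankNewtonBounds.mono {f : E → F} {x : E} {ρ ρ' b L : ℝ} (h : RankNewtonBounds f x ρ b L)
    (hρ : ρ' ≤ ρ) : RankNewtonBounds f x ρ' b L where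
  rank_eq u hu := h.rank_eq u (hu.trans_le hρ)
  moorePenrose_le u hu := h.moorePenrose_le u (hu.trans_le hρ)
  fderiv_lipschitz u v hu hv := h.fderiv_lipschitz u v (hu.trans_le hρ) (hv.trans_le hρ)
  lipschitz u v hu hv := h.lipschitz u v (hu.trans_le hρ) (hv.trans_le hρ)
  taylor u v hu hv := h.taylor u v (hu.trans_le hρ) (hv.trans_le hρ)

/-- Semicontinuity supplies the lower bound on the rank that complements `hle`; the derivative of a
`C²` map is locally Lipschitz, and the mean value inequality on a segment turns this into the Taylor
bound. -/
theorem exists_rankNewtonBounds {f : E → F} (hf : ContDiff ℂ 2 f) (x : E)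
    (hle : ∀ᶠ u in 𝓝 x, mapRank (fderiv ℂ f u) ≤ mapRank (fderiv ℂ f x)) :
    ∃ ρ > 0, ∃ b > 0, ∃ L > 0, RankNewtonBounds f x ρ b L := by
  have hJ : ContDiff ℂ 1 (fderiv ℂ f) := hf.fderiv_right (by norm_num)
  obtain ⟨L₁, s₁, hs₁, hL₁⟩ := hJ.contDiffAt.exists_lipschitzOnWith (x := x)
  obtain ⟨L₂, s₂, hs₂, hL₂⟩ := (hf.of_le one_le_two).contDiffAt.exists_lipschitzOnWith (x := x)
  obtain ⟨b, hb, η, hη, hMP⟩ := exists_norm_moorePenrose_le (fderiv ℂ f x)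
  have hnear : ∀ᶠ u in 𝓝 x, ‖fderiv ℂ f u - fderiv ℂ f x‖ < η :=
    (tendsto_iff_norm_sub_tendsto_zero.1 hJ.continuous.continuousAt).eventually_lt_const hη
  obtain ⟨ρ, hρ, hball⟩ := Metric.eventually_nhds_iff.1
    (((hle.and hnear).and (eventually_mem_set.2 hs₁)).and (eventually_mem_set.2 hs₂))
  simp only [dist_eq_norm] at hball
  set L : ℝ := max (max L₁ L₂) 1
  have h1L : (L₁ : ℝ) ≤ L := (le_max_left _ _).trans (le_max_left _ _)
  have h2L : (L₂ : ℝ) ≤ L := (le_max_right _ _).trans (le_max_left _ _)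
  have hlip : ∀ u v, ‖u - x‖ < ρ → ‖v - x‖ < ρ →
      ‖fderiv ℂ f v - fderiv ℂ f u‖ ≤ L * ‖v - u‖ := fun u v hu hv =>
    (hL₁.norm_sub_le (hball hv).1.2 (hball hu).1.2).trans (by gcongr)
  refine ⟨ρ, hρ, b, hb, L, lt_of_lt_of_le one_pos (le_max_right _ _), ?_, ?_, hlip, ?_, ?_⟩
  · exact fun u hu => (hMP _ (hball hu).1.1.2.le (hball hu).1.1.1).1
  · exact fun u hu => (hMP _ (hball hu).1.1.2.le (hball hu).1.1.1).2
  · exact fun u v hu hv => (hL₂.norm_sub_le (hball hv).2 (hball hu).2).trans (by gcongr)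
  · intro u v hu hv
    let _ : NormedSpace ℝ E := NormedSpace.restrictScalars ℝ ℂ E
    have hconv : Convex ℝ (segment ℝ u v) := convex_segment u v
    have hmem : ∀ w ∈ segment ℝ u v, ‖w - x‖ < ρ := fun w hw => by
      have := (convex_ball x ρ).segment_subset (mem_ball_iff_norm.2 hu) (mem_ball_iff_norm.2 hv) hw
      exact mem_ball_iff_norm.1 this
    have hw : ∀ w ∈ segment ℝ u v, ‖fderiv ℂ f w - fderiv ℂ f u‖ ≤ L * ‖v - u‖ := fun w hw => by
      refine (hlip u w hu (hmem w hw)).trans ?_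
      gcongr
      exact norm_sub_le_of_mem_segment hw
    have := hconv.norm_image_sub_le_of_norm_hasFDerivWithin_le'
      (fun w _ => ((hf.differentiable two_ne_zero) w).hasFDerivAt.hasFDerivWithinAt) hw
      (left_mem_segment ℝ u v) (right_mem_segment ℝ u v)
    exact this.trans_eq (by ring)

variable {f : E → F} {x : E} {ρ b L : ℝ}

theorem fderiv_sub_const_eq (f : E → F) (q : F) (u : E) :
    fderiv ℂ (fun u => f u - q) u = fderiv ℂ f u := fderiv_sub_const q

theorem rankNewton_succ_of_bounds (h : RankNewtonBounds f x ρ b L) {r : ℕ}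
    (hr : mapRank (fderiv ℂ f x) = r) (q : F) (u₀ : E) (j : ℕ)
    (hj : ‖rankNewton r (fun u => f u - q) u₀ j - x‖ < ρ) :
    rankNewton r (fun u => f u - q) u₀ (j + 1) = rankNewton r (fun u => f u - q) u₀ j -
      moorePenrose (fderiv ℂ f (rankNewton r (fun u => f u - q) u₀ j))
        (f (rankNewton r (fun u => f u - q) u₀ j) - q) := by
  rw [rankNewton, fderiv_sub_const_eq, rankProjection_eq_self ((h.rank_eq _ hj).trans hr)]

/-- The length of a rank-`r` Newton step in terms of the previous step. -/
theorem RankNewtonBounds.norm_step_le (h : RankNewtonBounds f x ρ b L) (hb : 0 < b)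
    (q : F) {u v : E}
    (hu : ‖u - x‖ < ρ) (hv : ‖v - x‖ < ρ)
    (huv : v = u - moorePenrose (fderiv ℂ f u) (f u - q)) :
    ‖moorePenrose (fderiv ℂ f v) (f v - q)‖ ≤
      b ^ 2 * L * ‖f u - q‖ * ‖v - u‖ + b * L * ‖v - u‖ ^ 2 := by
  have hd : v - u = - moorePenrose (fderiv ℂ f u) (f u - q) := by rw [huv]; abel
  -- The first summand is the part of the old residual orthogonal to the range of the old
  -- derivative; the second is the Taylor remainder.
  have hsplit : f v - q = ((f u - q) - fderiv ℂ f u (moorePenrose (fderiv ℂ f u) (f u - q)))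
      + (f v - f u - fderiv ℂ f u (v - u)) := by
    rw [hd, map_neg]; abel
  rw [hsplit, map_add]
  refine (norm_add_le _ _).trans (add_le_add ?_ ?_)
  · refine (norm_moorePenrose_sub_le (h.moorePenrose_le v hv) _).trans ?_
    calc b ^ 2 * ‖fderiv ℂ f v - fderiv ℂ f u‖ * ‖f u - q‖
        ≤ b ^ 2 * (L * ‖v - u‖) * ‖f u - q‖ := by gcongr; exact h.fderiv_lipschitz u v hu hv
      _ = _ := by ring
  · calc _ ≤ b * ‖f v - f u - fderiv ℂ f u (v - u)‖ := h.moorePenrose_le v hv _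
      _ ≤ b * (L * ‖v - u‖ ^ 2) := by gcongr; exact h.taylor u v hu hv
      _ = _ := by ring

theorem RankNewtonBounds.norm_sub_le (h : RankNewtonBounds f x ρ b L) (hρ : 0 < ρ)
    {q : F} {u : E} {τ : ℝ} (hτ : τ ≤ ρ) (hu : ‖u - x‖ < τ) {ε : ℝ} (hq : ‖q - f x‖ < ε) :
    ‖f u - q‖ ≤ L * ‖u - x‖ + ε := by
  have h1 := h.lipschitz x u (by simpa using hρ) (hu.trans_le hτ)
  have h2 : f u - q = (f u - f x) - (q - f x) := by abel
  rw [h2]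
  exact (_root_.norm_sub_le _ _).trans (add_le_add h1 hq.le)

/-- The residual is at most `(L + 1) * ρ` and the step at most `b` times that, so `hsmall` makes
each of the two terms of `norm_step_le` at most a quarter of the step. -/
theorem RankNewtonBounds.norm_step_le_half (h : RankNewtonBounds f x ρ b L) (hρ : 0 < ρ)
    (hb : 0 < b) (hL : 0 < L) (hsmall : b ^ 2 * L * ((L + 1) * ρ) ≤ 1 / 4) {q : F}
    (hq : ‖q - f x‖ < ρ) {u v : E} (hu : ‖u - x‖ < ρ) (hv : ‖v - x‖ < ρ)
    (huv : v = u - moorePenrose (fderiv ℂ f u) (f u - q)) :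
    ‖moorePenrose (fderiv ℂ f v) (f v - q)‖ ≤ 1 / 2 * ‖v - u‖ := by
  have h1 := h.norm_step_le hb q hu hv huv
  have h2 : ‖f u - q‖ ≤ (L + 1) * ρ :=
    (h.norm_sub_le hρ le_rfl hu hq).trans (by nlinarith)
  have h3 : ‖v - u‖ ≤ b * ((L + 1) * ρ) := by
    rw [huv, sub_sub_cancel_left, norm_neg]
    exact (h.moorePenrose_le u hu _).trans (by gcongr)
  have h4 : b ^ 2 * L * ‖f u - q‖ ≤ 1 / 4 := le_trans (by gcongr) hsmall
  have h5 : b * L * ‖v - u‖ ≤ 1 / 4 := by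
    refine le_trans ?_ hsmall
    calc b * L * ‖v - u‖ ≤ b * L * (b * ((L + 1) * ρ)) := by gcongr
      _ = _ := by ring
  nlinarith [norm_nonneg (v - u)]

/-- The iterates stay in the ball and their steps shrink geometrically. -/
theorem RankNewtonBounds.iterates (h : RankNewtonBounds f x ρ b L) (hρ : 0 < ρ)
    (hb : 0 < b) (hL : 0 < L) (hsmall : b ^ 2 * L * ((L + 1) * ρ) ≤ 1 / 4) {r : ℕ}
    (hr : mapRank (fderiv ℂ f x) = r) {δ : ℝ} (hδ0 : 0 < δ) (hδ : δ * (1 + 2 * b * (L + 1)) ≤ ρ)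
    {q : F} (hq : ‖q - f x‖ < δ) {u₀ : E} (hu₀ : ‖u₀ - x‖ < δ) (j : ℕ) :
    ‖rankNewton r (fun u => f u - q) u₀ j - x‖ <
      δ + 2 * (b * (L + 1) * δ) * (1 - (1 / 2) ^ j) ∧
    ‖rankNewton r (fun u => f u - q) u₀ j - x‖ < ρ ∧
    ‖rankNewton r (fun u => f u - q) u₀ (j + 1) - rankNewton r (fun u => f u - q) u₀ j‖ ≤
      (b * (L + 1) * δ) * (1 / 2) ^ j := by
  set N := rankNewton r (fun u => f u - q) u₀ with hN
  have hδρ : δ ≤ ρ := by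
    have : 0 < 2 * b * (L + 1) * δ := by positivity
    linarith
  have hD : 0 < b * (L + 1) * δ := by positivity
  -- The radius is `δ` plus the partial sum of the geometric bounds on the first `i` steps.
  have hrad : ∀ i : ℕ, δ + 2 * (b * (L + 1) * δ) * (1 - (1 / 2) ^ i) ≤ ρ := fun i => by
    have h1 : (0 : ℝ) < (1 / 2) ^ i := by positivity
    nlinarith
  induction j with
  | zero =>
    have h0 : N 0 = u₀ := rfl
    refine ⟨by simpa [h0] using hu₀, by rw [h0]; exact hu₀.trans_le hδρ, ?_⟩
    have hs := rankNewton_succ_of_bounds h hr q u₀ 0 (hu₀.trans_le hδρ)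
    rw [← hN, h0] at hs
    rw [hs, h0, sub_sub_cancel_left, norm_neg, pow_zero, mul_one]
    refine (h.moorePenrose_le u₀ (hu₀.trans_le hδρ) _).trans ?_
    have h1 := h.norm_sub_le hρ hδρ hu₀ hq
    rw [mul_assoc]
    gcongr
    nlinarith
  | succ j ih =>
    obtain ⟨h1, h2, h3⟩ := ih
    have hlt : ‖N (j + 1) - x‖ < δ + 2 * (b * (L + 1) * δ) * (1 - (1 / 2) ^ (j + 1)) := by
      have h4 : N (j + 1) - x = (N (j + 1) - N j) + (N j - x) := by abel
      rw [h4]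
      refine (norm_add_le _ _).trans_lt ?_
      rw [pow_succ]
      linarith
    have hlt' := hlt.trans_le (hrad (j + 1))
    refine ⟨hlt, hlt', ?_⟩
    have hs := rankNewton_succ_of_bounds h hr q u₀ (j + 1) hlt'
    rw [← hN] at hs
    rw [hs, sub_sub_cancel_left, norm_neg]
    have h5 := h.norm_step_le_half hρ hb hL hsmall (hq.trans_le hδρ) h2 hlt'
      (rankNewton_succ_of_bounds h hr q u₀ j h2)
    refine h5.trans ?_
    rw [pow_succ]
    linarith

/-- The rank-`r` Newton iteration converges to a stationary point of the least squares problem. -/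
theorem RankNewtonBounds.exists_tendsto (h : RankNewtonBounds f x ρ b L) (hf : ContDiff ℂ 2 f)
    (hρ : 0 < ρ) (hb : 0 < b) (hL : 0 < L) (hsm : b ^ 2 * L * ((L + 1) * ρ) ≤ 1 / 4)
    {r : ℕ} (hr : mapRank (fderiv ℂ f x) = r) {δ : ℝ} (hδ0 : 0 < δ)
    (hδ : δ * (1 + 2 * b * (L + 1)) ≤ ρ / 2)
    {q : F} (hq : ‖q - f x‖ < δ) {u₀ : E} (hu₀ : ‖u₀ - x‖ < δ) :
    ∃ w : E, Tendsto (rankNewton r (fun u => f u - q) u₀) atTop (𝓝 w) ∧ ‖w - x‖ < ρ ∧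
      (∀ v, inner ℂ (fderiv ℂ f w v) (f w - q) = 0) ∧
      (f w = q → ∀ j, ‖rankNewton r (fun u => f u - q) u₀ (j + 1) - w‖ ≤
        2 * (2 * b ^ 3 * L ^ 3) * ‖rankNewton r (fun u => f u - q) u₀ j - w‖ ^ 2) := by
  -- Keeping the iterates in the ball of radius `ρ / 2` leaves their limit inside the open ball of
  -- radius `ρ`, where all bounds still apply.
  have hsm' : b ^ 2 * L * ((L + 1) * (ρ / 2)) ≤ 1 / 4 := le_trans (by gcongr; linarith) hsm
  have hit := (h.mono (half_le_self hρ.le)).iterates (half_pos hρ) hb hL hsm' hr hδ0 hδ hq hu₀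
  have hδρ : δ ≤ ρ := by
    have : 0 < 2 * b * (L + 1) * δ := by positivity
    linarith
  set N := rankNewton r (fun u => f u - q) u₀ with hN
  have hin : ∀ j, ‖N j - x‖ < ρ := fun j => (hit j).2.1.trans (half_lt_self hρ)
  have hdist : ∀ j, dist (N j) (N (j + 1)) ≤ (b * (L + 1) * δ) * (1 / 2) ^ j := fun j => by
    rw [dist_comm, dist_eq_norm]
    exact (hit j).2.2
  obtain ⟨w, hw⟩ := cauchySeq_tendsto_of_complete
    (cauchySeq_of_le_geometric (1 / 2) _ (by norm_num) hdist)
  have hwx : ‖w - x‖ < ρ := by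
    refine lt_of_le_of_lt (le_of_tendsto (hw.sub_const x).norm ?_) (half_lt_self hρ)
    exact Eventually.of_forall fun j => (hit j).2.1.le
  have hstep : ∀ j, N (j + 1) = N j - moorePenrose (fderiv ℂ f (N j)) (f (N j) - q) :=
    fun j => rankNewton_succ_of_bounds h hr q u₀ j (hin j)
  refine ⟨w, hw, hwx, fun v => ?_, fun hfw j => ?_⟩
  · have hJc : Continuous (fderiv ℂ f) := hf.continuous_fderiv two_ne_zero
    have hJ : Tendsto (fun j => fderiv ℂ f (N j)) atTop (𝓝 (fderiv ℂ f w)) :=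
      (hJc.tendsto w).comp hw
    have hJv : Tendsto (fun j => fderiv ℂ f (N j) v) atTop (𝓝 (fderiv ℂ f w v)) :=
      (isBoundedBilinearMap_apply (𝕜 := ℂ) (E := E) (F := F)).continuous.continuousAt.tendsto.comp
        (hJ.prodMk_nhds tendsto_const_nhds)
    have hlim1 : Tendsto (fun j => inner ℂ (fderiv ℂ f (N j) v) (f (N j) - q)) atTop
        (𝓝 (inner ℂ (fderiv ℂ f w v) (f w - q))) :=
      hJv.inner (((hf.continuous.tendsto w).comp hw).sub_const q)
    -- Against the range of the derivative, the residual may be replaced by its projection, which is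
    -- the derivative applied to `N j - N (j + 1)`; this tends to zero.
    have hlim2 : Tendsto (fun j => inner ℂ (fderiv ℂ f (N j) v)
        (fderiv ℂ f (N j) (N j - N (j + 1)))) atTop
        (𝓝 (inner ℂ (fderiv ℂ f w v) (fderiv ℂ f w (w - w)))) :=
      hJv.inner ((isBoundedBilinearMap_apply (𝕜 := ℂ) (E := E) (F := F)).continuous.continuousAt.tendsto.comp
        (hJ.prodMk_nhds (hw.sub (hw.comp (tendsto_add_atTop_nat 1)))))
    rw [sub_self, map_zero, inner_zero_right] at hlim2
    refine tendsto_nhds_unique hlim1 (hlim2.congr fun j => ?_)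
    have h1 := inner_map_sub_map_moorePenrose (fderiv ℂ f (N j)) v (f (N j) - q)
    rw [inner_sub_right, sub_eq_zero] at h1
    rw [h1, hstep j, sub_sub_cancel]
  · have he : ‖f (N j) - q‖ ≤ L * ‖N j - w‖ := by
      rw [← hfw]
      exact h.lipschitz w (N j) hwx (hin j)
    have hd : ‖N (j + 1) - N j‖ ≤ b * (L * ‖N j - w‖) := by
      rw [hstep j, sub_sub_cancel_left, norm_neg]
      exact (h.moorePenrose_le _ (hin j) _).trans (by gcongr)
    -- When `f w = q`, the residual and the step at `N j` are both of order `‖N j - w‖`, so both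
    -- terms of the step bound are quadratic. Later steps halve, so their sum only doubles this
    -- constant.
    have hd' : ‖N (j + 2) - N (j + 1)‖ ≤ 2 * b ^ 3 * L ^ 3 * ‖N j - w‖ ^ 2 := by
      rw [hstep (j + 1), sub_sub_cancel_left, norm_neg]
      refine (h.norm_step_le hb q (hin j) (hin (j + 1)) (hstep j)).trans ?_
      calc b ^ 2 * L * ‖f (N j) - q‖ * ‖N (j + 1) - N j‖ + b * L * ‖N (j + 1) - N j‖ ^ 2
          ≤ b ^ 2 * L * (L * ‖N j - w‖) * (b * (L * ‖N j - w‖))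
            + b * L * (b * (L * ‖N j - w‖)) ^ 2 := by gcongr
        _ = _ := by ring
    have hhalf : ∀ i, ‖N (j + 1 + i + 1) - N (j + 1 + i)‖ ≤
        2 * b ^ 3 * L ^ 3 * ‖N j - w‖ ^ 2 * (1 / 2) ^ i := fun i => by
      induction i with
      | zero => simpa using hd'
      | succ i ih =>
        have h5 := h.norm_step_le_half hρ hb hL hsm (hq.trans_le hδρ) (hin (j + 1 + i))
          (hin (j + 1 + i + 1)) (hstep (j + 1 + i))
        rw [← add_assoc, hstep (j + 1 + i + 1), sub_sub_cancel_left, norm_neg]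
        refine h5.trans ?_
        rw [pow_succ (1 / 2 : ℝ) i]
        linarith
    have hlim : Tendsto (fun i => N (j + 1 + i)) atTop (𝓝 w) := by
      have := hw.comp (tendsto_add_atTop_nat (j + 1))
      refine this.congr fun i => ?_
      simp [add_comm]
    have := dist_le_of_le_geometric_of_tendsto₀ (1 / 2)
      (2 * b ^ 3 * L ^ 3 * ‖N j - w‖ ^ 2) (by norm_num)
      (fun i => by rw [dist_comm, dist_eq_norm]; exact hhalf i) hlim
    rw [dist_eq_norm, add_zero] at this
    refine this.trans_eq ?_
    ring

/-- A smooth parametrization through `x` whose tangent space at `x` is `K` meets every affine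
space orthogonal to `K` that passes near `x`. -/
theorem eventually_exists_sub_mem_orthogonal {G : Type*} [NormedAddCommGroup G] [NormedSpace ℂ G]
    [FiniteDimensional ℂ G] {g : G → E} {g' : G →L[ℂ] E} (hg : HasStrictFDerivAt g g' 0)
    (P : Set E) (hP : P ∈ 𝓝 (g 0)) :
    ∀ᶠ u in 𝓝 (g 0), ∃ s, g s ∈ P ∧ u - g s ∈ (LinearMap.range (g' : G →ₗ[ℂ] E))ᗮ := by
  have _ : CompleteSpace G := FiniteDimensional.complete ℂ G
  set K := LinearMap.range (g' : G →ₗ[ℂ] E) with hK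
  have hh : HasStrictFDerivAt (fun s => K.orthogonalProjectionOnto (g s))
      (K.orthogonalProjectionOnto ∘L g') 0 :=
    (K.orthogonalProjectionOnto.hasStrictFDerivAt (x := g 0)).comp 0 hg
  have hsurj : (K.orthogonalProjectionOnto ∘L g').range = ⊤ := by
    rw [LinearMap.range_eq_top]
    rintro ⟨_, s, rfl⟩
    exact ⟨s, Submodule.orthogonalProjectionOnto_mem_subspace_eq_self (K := K) ⟨g' s, s, rfl⟩⟩
  -- The projection of `g` onto `K` has surjective derivative, hence is open at `0`: each `u` near
  -- `g 0` shares its `K`-projection with some nearby `g s`.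
  have hmap := hh.map_nhds_eq_of_surj hsurj
  have hPs : {s | g s ∈ P} ∈ 𝓝 (0 : G) := hg.continuousAt hP
  have himg := image_mem_map (m := fun s => K.orthogonalProjectionOnto (g s)) hPs
  rw [hmap] at himg
  filter_upwards [K.orthogonalProjectionOnto.continuous.continuousAt himg] with u hu
  obtain ⟨s, hs, hsu⟩ := hu
  refine ⟨s, hs, ?_⟩
  rw [← Submodule.orthogonalProjectionOnto_eq_zero_iff, map_sub, ← hsu, sub_self]

/-- Convergence and stability of the rank-`r` Newton iteration near a point `g 0` of a smoothly
parametrized set of solutions of `f u = p` whose tangent space is the kernel of `f'`. -/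
theorem rankNewton_convergence {G : Type*} [NormedAddCommGroup G] [NormedSpace ℂ G]
    [FiniteDimensional ℂ G] {g : G → E} {g' : G →L[ℂ] E} (hg : HasStrictFDerivAt g g' 0)
    (hf : ContDiff ℂ 2 f) {p : F} (hfg : ∀ s, f (g s) = p)
    (hker : LinearMap.range (g' : G →ₗ[ℂ] E) =
      LinearMap.ker (fderiv ℂ f (g 0) : E →ₗ[ℂ] F)) {r : ℕ}
    (hr : mapRank (fderiv ℂ f (g 0)) = r)
    (hle : ∀ᶠ u in 𝓝 (g 0), mapRank (fderiv ℂ f u) ≤ r) :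
    ∃ δ > 0, ∃ ε > 0, ∃ C > 0, ∃ M > 0,
      ∀ q : F, ‖q - p‖ < ε → ∀ u₀ : E, ‖u₀ - g 0‖ < δ →
        (∀ j, ∃! B, IsRankProjection r
          (fderiv ℂ (fun u => f u - q) (rankNewton r (fun u => f u - q) u₀ j)) B) ∧
        ∃ w : E, Tendsto (rankNewton r (fun u => f u - q) u₀) atTop (𝓝 w) ∧
          (∃ s, ‖w - g s‖ ≤
            2 * ‖moorePenrose (rankProjection r (fderiv ℂ (fun u => f u - p) (g 0)))‖ * ‖q - p‖
              + C * ‖q - p‖ ^ 2) ∧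
          (q = p → ∀ j, ‖rankNewton r (fun u => f u - q) u₀ (j + 1) - w‖ ≤
            M * ‖rankNewton r (fun u => f u - q) u₀ j - w‖ ^ 2) := by
  set x := g 0 with hx
  set J := fderiv ℂ f x with hJ
  obtain ⟨ρ₀, hρ₀, b, hb, L, hL, hbd⟩ := exists_rankNewtonBounds hf x (by rwa [← hJ, hr])
  set m := ‖moorePenrose J‖ with hm
  -- Chosen so that `m * (3 * η) ≤ 1 / 2`, which lets the nonlinear error be absorbed; `ρ₁` then
  -- makes `L * ρ₁ ≤ η`.
  set η := 1 / (6 * (m + 1)) with hη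
  have hm0 : 0 ≤ m := norm_nonneg _
  have hη0 : 0 < η := by positivity
  set ρ₁ := min ρ₀ (η / L) with hρ₁
  have hρ₁0 : 0 < ρ₁ := by positivity
  have hev := eventually_exists_sub_mem_orthogonal hg (Metric.ball x ρ₁) (Metric.ball_mem_nhds x hρ₁0)
  obtain ⟨ρ₂, hρ₂, hslice⟩ := Metric.eventually_nhds_iff.1 hev
  set ρ := min (min ρ₁ ρ₂) (1 / (4 * (b ^ 2 * L * (L + 1)))) with hρdef
  have hρ : 0 < ρ := by positivity
  have hsm : b ^ 2 * L * ((L + 1) * ρ) ≤ 1 / 4 := by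
    calc b ^ 2 * L * ((L + 1) * ρ)
        ≤ b ^ 2 * L * ((L + 1) * (1 / (4 * (b ^ 2 * L * (L + 1))))) := by
          gcongr; exact min_le_right _ _
      _ = 1 / 4 := by field_simp
  have hρρ₁ : ρ ≤ ρ₁ := (min_le_left _ _).trans (min_le_left _ _)
  have hρρ₂ : ρ ≤ ρ₂ := (min_le_left _ _).trans (min_le_right _ _)
  have hρρ₀ : ρ ≤ ρ₀ := hρρ₁.trans (min_le_left _ _)
  have hb' := hbd.mono hρρ₀
  set δ := ρ / 2 / (1 + 2 * b * (L + 1)) with hδ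
  have hδ0 : 0 < δ := by positivity
  have hδρ : δ * (1 + 2 * b * (L + 1)) ≤ ρ / 2 := by
    rw [hδ, div_mul_cancel₀ _ (by positivity)]
  have hfx : f x = p := hfg 0
  -- The quadratic error term is not needed, because the linear bound already holds with factor 2;
  -- any positive `C` serves.
  refine ⟨δ, hδ0, δ, hδ0, 1, one_pos, 2 * (2 * b ^ 3 * L ^ 3), by positivity,
    fun q hq u₀ hu₀ => ?_⟩
  rw [← hfx] at hq
  have hit := (hb'.mono (half_le_self hρ.le)).iterates (half_pos hρ) hb hL
    (le_trans (by gcongr; linarith) hsm) hr hδ0 hδρ hq hu₀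
  obtain ⟨w, hw, hwx, hstat, hquad⟩ := hb'.exists_tendsto hf hρ hb hL hsm hr hδ0 hδρ hq hu₀
  have hmain : ∃ s, ‖w - g s‖ ≤ 2 * m * ‖q - p‖ := by
    obtain ⟨s, hs, hsK⟩ := hslice (show dist w x < ρ₂ by
      rw [dist_eq_norm]; exact hwx.trans_le hρρ₂)
    refine ⟨s, ?_⟩
    have hsx : ‖g s - x‖ < ρ₁ := mem_ball_iff_norm.1 hs
    rw [hker] at hsK
    set e := w - g s with he
    have hLρ : L * ρ₁ ≤ η := by
      calc L * ρ₁ ≤ L * (η / L) := by gcongr; exact min_le_right _ _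
        _ = η := by field_simp
    have h1 : ‖fderiv ℂ f w - J‖ ≤ η := by
      refine (hbd.fderiv_lipschitz x w (by simpa using hρ₀) (hwx.trans_le hρρ₀)).trans ?_
      refine le_trans ?_ hLρ
      gcongr
      exact hwx.le.trans hρρ₁
    have he2 : ‖e‖ ≤ 2 * ρ₁ := by
      have : e = (w - x) - (g s - x) := by rw [he]; abel
      rw [this]
      exact (norm_sub_le _ _).trans (by linarith)
    have h2 : ‖fderiv ℂ f w e - (f w - p)‖ ≤ 2 * η * ‖e‖ := by
      have h3 := hbd.taylor w (g s) (hwx.trans_le hρρ₀) (hsx.trans_le (min_le_left _ _))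
      have h4 : f (g s) - f w - fderiv ℂ f w (g s - w) = fderiv ℂ f w e - (f w - p) := by
        rw [hfg, ← neg_sub w (g s), ← he, map_neg]; abel
      rw [h4, norm_sub_rev (g s) w, ← he] at h3
      refine h3.trans ?_
      calc L * ‖e‖ ^ 2 = L * ‖e‖ * ‖e‖ := by ring
        _ ≤ L * (2 * ρ₁) * ‖e‖ := by gcongr
        _ = 2 * (L * ρ₁) * ‖e‖ := by ring
        _ ≤ _ := by gcongr
    -- By stationarity `f w - q` is orthogonal to `z`, so it drops out when `z` is paired with
    -- itself.
    have h5 : ‖fderiv ℂ f w e‖ ≤ ‖q - p‖ + 2 * η * ‖e‖ := by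
      set z := fderiv ℂ f w e with hz
      have h6 : inner ℂ z z = inner ℂ z ((q - p) + (z - (f w - p))) := by
        have h7 : z = ((q - p) + (z - (f w - p))) + (f w - q) := by abel
        refine (congrArg (inner ℂ z) h7).trans ?_
        rw [inner_add_right, hz, hstat e, add_zero]
      have h8 : ‖z‖ ^ 2 ≤ ‖z‖ * ‖(q - p) + (z - (f w - p))‖ := by
        have h9 := norm_inner_le_norm (𝕜 := ℂ) z ((q - p) + (z - (f w - p)))
        rw [← h6, inner_self_eq_norm_sq_to_K] at h9
        simpa using h9
      have h10 : ‖z‖ ≤ ‖(q - p) + (z - (f w - p))‖ := by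
        by_contra! hlt
        nlinarith [norm_nonneg ((q - p) + (z - (f w - p)))]
      exact h10.trans ((norm_add_le _ _).trans (add_le_add le_rfl h2))
    have h11 : ‖J e‖ ≤ ‖q - p‖ + 3 * η * ‖e‖ := by
      have h12 : J e = fderiv ℂ f w e - (fderiv ℂ f w - J) e := by simp
      rw [h12]
      have h13 := (fderiv ℂ f w - J).le_of_opNorm_le h1 e
      exact (norm_sub_le _ _).trans (by linarith)
    have h14 : ‖e‖ ≤ m * (‖q - p‖ + 3 * η * ‖e‖) := by
      conv_lhs => rw [← moorePenrose_map_of_mem_orthogonal J hsK]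
      exact ((moorePenrose J).le_opNorm _).trans (by gcongr)
    have h15 : m * (3 * η * ‖e‖) ≤ 1 / 2 * ‖e‖ := by
      have h16 : m * (3 * η) ≤ 1 / 2 := by
        calc m * (3 * η) ≤ (m + 1) * (3 * η) := by gcongr; linarith
          _ = 1 / 2 := by rw [hη]; field_simp; norm_num
      calc m * (3 * η * ‖e‖) = m * (3 * η) * ‖e‖ := by ring
        _ ≤ _ := by gcongr
    linarith
  refine ⟨fun j => ?_, w, hw, ?_, ?_⟩
  · rw [fderiv_sub_const_eq]
    exact existsUnique_isRankProjection
      ((hb'.rank_eq _ ((hit j).2.1.trans (half_lt_self hρ))).trans hr)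
  · obtain ⟨s, hs⟩ := hmain
    refine ⟨s, hs.trans ?_⟩
    rw [fderiv_sub_const_eq, rankProjection_eq_self hr]
    exact le_add_of_nonneg_right (by positivity)
  · intro hqp
    -- For `q = p` the error bound is zero, so `w` equals some `g s` and is an exact solution.
    refine hquad ?_
    obtain ⟨s, hs⟩ := hmain
    rw [hqp, sub_self, norm_zero, mul_zero] at hs
    rw [sub_eq_zero.1 (norm_le_zero_iff.1 hs), hfg, hqp]

end RankNewton

/-! ### Smoothness tested on functionals. -/

section SeparatingFunctionals

/-- In finite dimension a separating family spans the dual, so every coordinate of `f` is a linear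
combination of smooth functions. The family used below is evaluation at points. -/
theorem contDiff_of_separating_functionals {S E W : Type*} [NormedAddCommGroup E]
    [NormedSpace ℂ E] [NormedAddCommGroup W] [NormedSpace ℂ W] [FiniteDimensional ℂ W]
    {n : WithTop ℕ∞} (φ : S → Module.Dual ℂ W) (hφ : ∀ w, (∀ s, φ s w = 0) → w = 0) {f : E → W}
    (hf : ∀ s, ContDiff ℂ n fun x => φ s (f x)) : ContDiff ℂ n f := by
  have hspan : Submodule.span ℂ (Set.range φ) = ⊤ := by
    have h1 : (Submodule.span ℂ (Set.range φ)).dualCoannihilator = ⊥ := by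
      rw [eq_bot_iff]
      intro w hw
      rw [Submodule.mem_dualCoannihilator] at hw
      exact hφ w fun s => hw _ (Submodule.subset_span ⟨s, rfl⟩)
    have h2 := Subspace.finrank_add_finrank_dualCoannihilator_eq
      (Submodule.span ℂ (Set.range φ))
    rw [h1, finrank_bot, add_zero] at h2
    exact Submodule.eq_top_of_finrank_eq (h2.trans (Subspace.dual_finrank_eq (K := ℂ)).symm)
  have hdual : ∀ ψ : Module.Dual ℂ W, ContDiff ℂ n fun x => ψ (f x) := fun ψ => by
    have hψ : ψ ∈ Submodule.span ℂ (Set.range φ) := hspan ▸ Submodule.mem_top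
    induction hψ using Submodule.span_induction with
    | mem ψ h =>
      obtain ⟨s, rfl⟩ := h
      exact hf s
    | zero => simpa using contDiff_const
    | add ψ₁ ψ₂ _ _ h₁ h₂ => simpa using h₁.add h₂
    | smul c ψ _ h => simpa using contDiff_const.mul h
  let B := Module.finBasis ℂ W
  have hsum : f = fun x => ∑ i, B.coord i (f x) • B i := by
    funext x
    exact (B.sum_repr (f x)).symm
  rw [hsum]
  exact ContDiff.sum fun i _ => (hdual (B.coord i)).smul contDiff_const

end SeparatingFunctionals

/-! ### The scaling orbit and the Jacobian of the factorization map. -/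

section FactorMap

variable {σ : Type*} {k : ℕ} {V : Fin k → Type*}
  [∀ j, NormedAddCommGroup (V j)] [∀ j, InnerProductSpace ℂ (V j)]

/-- The orbit of `u` under the scalings of its factors that preserve the product. -/
noncomputable def scalingOrbit (ℓ : Fin k → ℕ) (u : FactorSpace V) (s : Fin k → ℂ) :
    FactorSpace V :=
  WithLp.toLp 2 (Complex.exp (-∑ j, ℓ j * s j) * u.fst,
    WithLp.toLp 2 fun j => Complex.exp (s j) • u.snd j)

/-- The tangent map of `scalingOrbit` at `u`. -/
noncomputable def scalingTangent (ℓ : Fin k → ℕ) (u : FactorSpace V) :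
    (Fin k → ℂ) →L[ℂ] FactorSpace V :=
  ((WithLp.prodContinuousLinearEquiv 2 ℂ ℂ (PiLp 2 V)).symm : ℂ × PiLp 2 V →L[ℂ] FactorSpace V) ∘L
    ((-∑ j, (ℓ j : ℂ) • ContinuousLinearMap.proj (R := ℂ) (φ := fun _ : Fin k => ℂ) j).smulRight
      u.fst).prod
    (((PiLp.continuousLinearEquiv 2 ℂ V).symm : (∀ j, V j) →L[ℂ] PiLp 2 V) ∘L
      ContinuousLinearMap.pi fun j =>
        (ContinuousLinearMap.proj (R := ℂ) (φ := fun _ : Fin k => ℂ) j).smulRight (u.snd j))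

theorem scalingTangent_snd (ℓ : Fin k → ℕ) (u : FactorSpace V) (c : Fin k → ℂ) (j : Fin k) :
    (scalingTangent ℓ u c).snd j = c j • u.snd j := rfl

theorem scalingOrbit_zero (ℓ : Fin k → ℕ) (u : FactorSpace V) : scalingOrbit ℓ u 0 = u := by
  simp only [scalingOrbit, Pi.zero_apply, mul_zero, Finset.sum_const_zero, neg_zero,
    Complex.exp_zero, one_mul, one_smul]
  rfl

theorem hasStrictFDerivAt_scalingOrbit (ℓ : Fin k → ℕ) (u : FactorSpace V) :
    HasStrictFDerivAt (scalingOrbit ℓ u) (scalingTangent ℓ u) 0 := by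
  have hproj : ∀ j, HasStrictFDerivAt (fun s : Fin k → ℂ => s j)
      (ContinuousLinearMap.proj (R := ℂ) (φ := fun _ : Fin k => ℂ) j) 0 :=
    fun j => hasStrictFDerivAt_apply j 0
  have h1 : HasStrictFDerivAt (fun s : Fin k → ℂ => Complex.exp (-∑ j, ℓ j * s j) * u.fst)
      ((-∑ j, (ℓ j : ℂ) • ContinuousLinearMap.proj (R := ℂ) (φ := fun _ : Fin k => ℂ) j).smulRight
        u.fst) 0 := by
    have := ((HasStrictFDerivAt.fun_sum fun j (_ : j ∈ Finset.univ) =>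
      (hproj j).const_mul (ℓ j : ℂ)).neg.cexp).mul_const u.fst
    refine this.congr_fderiv ?_
    ext c
    simp [mul_comm]
  have h2 : HasStrictFDerivAt (fun s : Fin k → ℂ => fun j => Complex.exp (s j) • u.snd j)
      (ContinuousLinearMap.pi fun j =>
        (ContinuousLinearMap.proj (R := ℂ) (φ := fun _ : Fin k => ℂ) j).smulRight (u.snd j)) 0 := by
    rw [hasStrictFDerivAt_pi]
    intro j
    have := (hproj j).cexp.smul_const (u.snd j)
    refine this.congr_fderiv ?_
    ext c
    simp
  have h3 := ((PiLp.continuousLinearEquiv 2 ℂ V).symm : (∀ j, V j) →L[ℂ] PiLp 2 V)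
    |>.hasStrictFDerivAt.comp 0 h2
  exact ((WithLp.prodContinuousLinearEquiv 2 ℂ ℂ (PiLp 2 V)).symm :
    ℂ × PiLp 2 V →L[ℂ] FactorSpace V).hasStrictFDerivAt.comp 0 (h1.prodMk h3)

theorem factorProduct_scalingOrbit (ι : ∀ j, V j →ₗ[ℂ] MvPolynomial σ ℂ) (ℓ : Fin k → ℕ)
    (u : FactorSpace V) (s : Fin k → ℂ) :
    factorProduct ι ℓ (scalingOrbit ℓ u s) = factorProduct ι ℓ u := by
  have h1 : (scalingOrbit ℓ u s).fst = Complex.exp (-∑ j, ℓ j * s j) * u.fst := rfl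
  have h2 : ∀ j, (scalingOrbit ℓ u s).snd j = Complex.exp (s j) • u.snd j := fun _ => rfl
  simp only [factorProduct, h1, h2, map_smul, MvPolynomial.smul_eq_C_mul, mul_pow,
    Finset.prod_mul_distrib, ← map_pow, ← map_prod, ← Complex.exp_nat_mul, ← Complex.exp_sum]
  rw [← mul_assoc, ← map_mul, mul_right_comm, ← Complex.exp_add, neg_add_cancel, Complex.exp_zero,
    one_mul]

theorem scalingOrbit_mem_factorArrays (ℓ : Fin k → ℕ) (u : FactorSpace V) (s : Fin k → ℂ) :
    scalingOrbit ℓ u s ∈ factorArrays ℓ u := by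
  refine ⟨fun j => Complex.exp (s j), fun j => Complex.exp_ne_zero _, ?_, fun j => rfl⟩
  simp only [← Complex.exp_nat_mul, ← Complex.exp_neg, ← Complex.exp_sum, Finset.sum_neg_distrib]
  rfl

theorem scalingTangent_injective (ℓ : Fin k → ℕ) {u : FactorSpace V} (hu : ∀ j, u.snd j ≠ 0) :
    Function.Injective (scalingTangent ℓ u) := by
  rw [injective_iff_map_eq_zero]
  intro c hc
  funext j
  have h : (scalingTangent ℓ u c).snd j = 0 := by rw [hc]; rfl
  rw [scalingTangent_snd] at h
  exact (smul_eq_zero.1 h).resolve_right (hu j)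

/-- The directional derivative of `factorProduct` at `u` along `v`. -/
noncomputable def factorProductDeriv (ι : ∀ j, V j →ₗ[ℂ] MvPolynomial σ ℂ) (ℓ : Fin k → ℕ)
    (u v : FactorSpace V) : MvPolynomial σ ℂ :=
  MvPolynomial.C v.fst * ∏ j, ι j (u.snd j) ^ ℓ j +
    MvPolynomial.C u.fst * ∑ j, (∏ i ∈ Finset.univ.erase j, ι i (u.snd i) ^ ℓ i) *
      (ℓ j * ι j (u.snd j) ^ (ℓ j - 1) * ι j (v.snd j))

variable [∀ j, FiniteDimensional ℂ (V j)]
  {W : Type*} [NormedAddCommGroup W] [InnerProductSpace ℂ W] [FiniteDimensional ℂ W]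
  {ι : ∀ j, V j →ₗ[ℂ] MvPolynomial σ ℂ} {ℓ : Fin k → ℕ} {κ : W →ₗ[ℂ] MvPolynomial σ ℂ}

/-- The value of the `j`-th factor at the point `z`, as a functional of the factor array. -/
noncomputable def evalFactor (ι : ∀ j, V j →ₗ[ℂ] MvPolynomial σ ℂ) (z : σ → ℂ) (j : Fin k) :
    FactorSpace V →L[ℂ] ℂ :=
  LinearMap.toContinuousLinearMap ((MvPolynomial.aeval z).toLinearMap ∘ₗ ι j) ∘L
    PiLp.proj 2 V j ∘L WithLp.sndL 2 ℂ ℂ (PiLp 2 V)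

theorem evalFactor_apply (z : σ → ℂ) (j : Fin k) (u : FactorSpace V) :
    evalFactor ι z j u = MvPolynomial.eval z (ι j (u.snd j)) := by
  rw [← MvPolynomial.coe_aeval_eq_eval]
  rfl

theorem eval_factorProduct (z : σ → ℂ) (u : FactorSpace V) :
    MvPolynomial.eval z (factorProduct ι ℓ u) =
      WithLp.fstL 2 ℂ ℂ (PiLp 2 V) u * ∏ j, evalFactor ι z j u ^ ℓ j := by
  simp only [factorProduct, map_mul, MvPolynomial.eval_C, map_prod, map_pow, evalFactor_apply]
  rfl

theorem contDiff_of_map_eq_factorProduct (hκ : Function.Injective κ) {f : FactorSpace V → W}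
    (hf : ∀ u, κ (f u) = factorProduct ι ℓ u) : ContDiff ℂ 2 f := by
  refine contDiff_of_separating_functionals
    (fun z : σ → ℂ => (MvPolynomial.aeval z).toLinearMap ∘ₗ κ) (fun w hw => hκ ?_) fun z => ?_
  · rw [map_zero]
    refine MvPolynomial.funext fun z => ?_
    rw [map_zero, ← MvPolynomial.coe_aeval_eq_eval]
    exact hw z
  · have h : (fun u => ((MvPolynomial.aeval z).toLinearMap ∘ₗ κ) (f u)) =
        fun u => WithLp.fstL 2 ℂ ℂ (PiLp 2 V) u * ∏ j, evalFactor ι z j u ^ ℓ j := by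
      funext u
      rw [← eval_factorProduct, ← hf, ← MvPolynomial.coe_aeval_eq_eval]
      rfl
    rw [h]
    exact (ContinuousLinearMap.contDiff _).mul
      (contDiff_prod fun j _ => (ContinuousLinearMap.contDiff _).pow _)

/-- After evaluation at a point this is the product rule for scalar functions, and a polynomial over
`ℂ` is determined by its values. -/
theorem map_fderiv_eq_factorProductDeriv (hκ : Function.Injective κ) {f : FactorSpace V → W}
    (hf : ∀ u, κ (f u) = factorProduct ι ℓ u) (u v : FactorSpace V) :
    κ (fderiv ℂ f u v) = factorProductDeriv ι ℓ u v := by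
  refine MvPolynomial.funext fun z => ?_
  let ψ : W →L[ℂ] ℂ := LinearMap.toContinuousLinearMap ((MvPolynomial.aeval z).toLinearMap ∘ₗ κ)
  have hψ : ∀ w, ψ w = MvPolynomial.eval z (κ w) := fun w => by
    rw [← MvPolynomial.coe_aeval_eq_eval]
    rfl
  have h1 : HasFDerivAt (fun x => ψ (f x)) (ψ ∘L fderiv ℂ f u) u :=
    ψ.hasFDerivAt.comp u
      ((contDiff_of_map_eq_factorProduct hκ hf).differentiable two_ne_zero u).hasFDerivAt
  have h2 := (WithLp.fstL 2 ℂ ℂ (PiLp 2 V)).hasFDerivAt (x := u) |>.mul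
    (HasFDerivAt.finsetProd (u := Finset.univ)
      fun j _ => ((evalFactor ι z j).hasFDerivAt (x := u)).pow (ℓ j))
  have h3 : (fun x => ψ (f x)) =
      fun u => WithLp.fstL 2 ℂ ℂ (PiLp 2 V) u * ∏ j, evalFactor ι z j u ^ ℓ j := by
    funext u
    rw [hψ, hf, eval_factorProduct]
  rw [h3] at h1
  have h4 := congrArg (fun T : FactorSpace V →L[ℂ] ℂ => T v) (h1.unique h2)
  simp only [ContinuousLinearMap.comp_apply, hψ] at h4
  rw [h4, factorProductDeriv]
  simp only [add_apply, smul_apply,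
    sum_apply, smul_eq_mul, nsmul_eq_mul, evalFactor_apply, map_add, map_mul,
    map_sum, map_prod, map_pow, MvPolynomial.eval_C, map_natCast]
  exact (add_comm _ _).trans (congrArg (· + _) (mul_comm _ _))

/-- The product is constant along the orbit, so the chain rule at `0` gives zero. -/
theorem fderiv_scalingTangent (hκ : Function.Injective κ) {f : FactorSpace V → W}
    (hf : ∀ u, κ (f u) = factorProduct ι ℓ u) (u : FactorSpace V) (c : Fin k → ℂ) :
    fderiv ℂ f u (scalingTangent ℓ u c) = 0 := by
  have h0 := scalingOrbit_zero ℓ u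
  have h1 : HasFDerivAt f (fderiv ℂ f u) (scalingOrbit ℓ u 0) := by
    rw [h0]
    exact ((contDiff_of_map_eq_factorProduct hκ hf).differentiable two_ne_zero u).hasFDerivAt
  have h2 := h1.comp 0 (hasStrictFDerivAt_scalingOrbit ℓ u).hasFDerivAt
  have h3 : f ∘ scalingOrbit ℓ u = fun _ => f u := by
    funext s
    refine hκ ?_
    rw [Function.comp_apply, hf, hf, factorProduct_scalingOrbit]
  rw [h3] at h2
  exact congrArg (fun T : (Fin k → ℂ) →L[ℂ] W => T c) (h2.unique (hasFDerivAt_const _ _))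

theorem range_scalingTangent_le (hκ : Function.Injective κ) {f : FactorSpace V → W}
    (hf : ∀ u, κ (f u) = factorProduct ι ℓ u) (u : FactorSpace V) :
    LinearMap.range (scalingTangent ℓ u : (Fin k → ℂ) →ₗ[ℂ] FactorSpace V) ≤
      LinearMap.ker (fderiv ℂ f u : FactorSpace V →ₗ[ℂ] W) := by
  rintro _ ⟨c, rfl⟩
  exact fderiv_scalingTangent hκ hf u c

theorem finrank_range_scalingTangent {u : FactorSpace V} (hu : ∀ j, u.snd j ≠ 0) :
    Module.finrank ℂ
      (LinearMap.range (scalingTangent ℓ u : (Fin k → ℂ) →ₗ[ℂ] FactorSpace V)) = k := by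
  rw [LinearMap.finrank_range_of_inj (scalingTangent_injective ℓ hu), Module.finrank_fin_fun]

theorem mapRank_fderiv_le (hκ : Function.Injective κ) {f : FactorSpace V → W}
    (hf : ∀ u, κ (f u) = factorProduct ι ℓ u) {u : FactorSpace V} (hu : ∀ j, u.snd j ≠ 0) :
    mapRank (fderiv ℂ f u) ≤ Module.finrank ℂ (FactorSpace V) - k := by
  have h1 := Submodule.finrank_mono (range_scalingTangent_le hκ hf u)
  rw [finrank_range_scalingTangent hu] at h1
  have h2 := LinearMap.finrank_range_add_finrank_ker (fderiv ℂ f u : FactorSpace V →ₗ[ℂ] W)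
  rw [mapRank]
  omega

/-- Every term of the derivative except the one differentiating the `j`-th power contains the full
power of the `j`-th factor, so that power divides the remaining term too. Cancelling all but one
copy, primality leaves only the `j`-th component of `v` to be divisible. -/
theorem dvd_of_factorProductDeriv_eq_zero {p : MvPolynomial σ ℂ} {u v : FactorSpace V}
    (hp : IsIrreducibleFactorization ι ℓ u p) (h : factorProductDeriv ι ℓ u v = 0) (j : Fin k) :
    ι j (u.snd j) ∣ ι j (v.snd j) := by
  classical
  set P : Fin k → MvPolynomial σ ℂ := fun i => ι i (u.snd i) with hP
  have hprime : Prime (P j) := (hp.irreducible j).prime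
  have hunit : ∀ a : ℂ, a ≠ 0 → ¬ P j ∣ MvPolynomial.C a := fun a ha hdvd =>
    hprime.not_isUnit (isUnit_of_dvd_unit hdvd ((isUnit_iff_ne_zero.2 ha).map MvPolynomial.C))
  have hpow : ∀ s : Finset (Fin k), j ∈ s → P j ^ ℓ j ∣ ∏ i ∈ s, P i ^ ℓ i := fun s hs =>
    Finset.dvd_prod_of_mem (fun i => P i ^ ℓ i) hs
  rw [factorProductDeriv, ← Finset.add_sum_erase _ _ (Finset.mem_univ j), mul_add] at h
  have h1 : P j ^ ℓ j ∣ MvPolynomial.C u.fst * ((∏ i ∈ Finset.univ.erase j, P i ^ ℓ i) *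
      ((ℓ j : MvPolynomial σ ℂ) * P j ^ (ℓ j - 1) * ι j (v.snd j))) := by
    have h2 : P j ^ ℓ j ∣ MvPolynomial.C v.fst * ∏ i, P i ^ ℓ i :=
      (hpow _ (Finset.mem_univ j)).mul_left _
    have h3 : P j ^ ℓ j ∣ MvPolynomial.C u.fst * ∑ i ∈ Finset.univ.erase j,
        (∏ m ∈ Finset.univ.erase i, P m ^ ℓ m) * ((ℓ i : MvPolynomial σ ℂ) * P i ^ (ℓ i - 1) * ι i (v.snd i)) := by
      refine (Finset.dvd_sum fun i hi => ?_).mul_left _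
      exact (hpow _ (Finset.mem_erase.2
        ⟨(Finset.ne_of_mem_erase hi).symm, Finset.mem_univ j⟩)).mul_right _
    rw [add_left_comm] at h
    have h4 := eq_neg_of_add_eq_zero_left h
    rw [h4]
    exact (h2.add h3).neg_right
  have h5 : P j ∣ MvPolynomial.C u.fst * ((∏ i ∈ Finset.univ.erase j, P i ^ ℓ i) *
      (MvPolynomial.C (ℓ j : ℂ) * ι j (v.snd j))) := by
    refine (mul_dvd_mul_iff_left (pow_ne_zero (ℓ j - 1) hprime.ne_zero)).1 ?_
    rw [← pow_succ, Nat.sub_add_cancel (hp.exponent_pos j)]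
    refine h1.trans (dvd_of_eq ?_)
    rw [map_natCast]
    ring
  have h6 := (hprime.dvd_or_dvd h5).resolve_left (hunit _ hp.const_ne_zero)
  rcases hprime.dvd_or_dvd h6 with h7 | h7
  · obtain ⟨i, hi, h8⟩ := hprime.exists_mem_finset_dvd h7
    have h9 : P j ∣ P i := hprime.dvd_of_dvd_pow h8
    exact absurd ((hp.irreducible j).associated_of_dvd (hp.irreducible i) h9)
      (hp.not_associated j i (Finset.ne_of_mem_erase hi).symm)
  · exact (hprime.dvd_or_dvd h7).resolve_left
      (hunit _ (Nat.cast_ne_zero.2 (hp.exponent_pos j).ne'))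

theorem ker_fderiv_eq_range_scalingTangent (hι : ∀ j, Function.Injective (ι j))
    (hκ : Function.Injective κ) {f : FactorSpace V → W}
    (hf : ∀ u, κ (f u) = factorProduct ι ℓ u) {u : FactorSpace V} {p : MvPolynomial σ ℂ}
    (hp : IsIrreducibleFactorization ι ℓ u p) (hhost : ∀ j, IsProperHost (ι j) (u.snd j)) :
    LinearMap.range (scalingTangent ℓ u : (Fin k → ℂ) →ₗ[ℂ] FactorSpace V) =
      LinearMap.ker (fderiv ℂ f u : FactorSpace V →ₗ[ℂ] W) := by
  refine le_antisymm (range_scalingTangent_le hκ hf u) fun v hv => ?_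
  have hv0 : fderiv ℂ f u v = 0 := hv
  have hd : factorProductDeriv ι ℓ u v = 0 := by
    rw [← map_fderiv_eq_factorProductDeriv hκ hf, hv0, map_zero]
  have hc : ∀ j, ∃ c : ℂ, v.snd j = c • u.snd j := fun j => by
    obtain ⟨s, hs⟩ := dvd_of_factorProductDeriv_eq_zero hp hd j
    obtain ⟨c, rfl⟩ := hhost j s ⟨v.snd j, by rw [hs, mul_comm]⟩
    refine ⟨c, hι j ?_⟩
    rw [hs, map_smul, MvPolynomial.smul_eq_C_mul, mul_comm]
  choose c hc using hc
  set e := v - scalingTangent ℓ u c with he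
  have he2 : ∀ j, e.snd j = 0 := fun j => by
    change v.snd j - (scalingTangent ℓ u c).snd j = 0
    rw [scalingTangent_snd, hc, sub_self]
  have he0 : fderiv ℂ f u e = 0 := by
    rw [he, map_sub, hv0, fderiv_scalingTangent hκ hf, sub_self]
  have hde := map_fderiv_eq_factorProductDeriv hκ hf u e
  rw [he0, map_zero, factorProductDeriv] at hde
  simp only [he2, map_zero, mul_zero, Finset.sum_const_zero, add_zero] at hde
  have hprod : ∏ j, ι j (u.snd j) ^ ℓ j ≠ 0 :=
    Finset.prod_ne_zero_iff.2 fun j _ => pow_ne_zero _ (hp.irreducible j).ne_zero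
  have he1 : e.fst = 0 := by
    have := (mul_eq_zero.1 hde.symm).resolve_right hprod
    simpa using this
  have hzero : e = 0 := by
    refine (WithLp.ext_iff (p := 2)).2 (Prod.ext he1 ?_)
    exact PiLp.ext he2
  exact ⟨c, (sub_eq_zero.1 hzero).symm⟩

theorem mapRank_fderiv_eq (hι : ∀ j, Function.Injective (ι j))
    (hκ : Function.Injective κ) {f : FactorSpace V → W}
    (hf : ∀ u, κ (f u) = factorProduct ι ℓ u) {u : FactorSpace V} {p : MvPolynomial σ ℂ}
    (hp : IsIrreducibleFactorization ι ℓ u p) (hhost : ∀ j, IsProperHost (ι j) (u.snd j))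
    (hu : ∀ j, u.snd j ≠ 0) :
    mapRank (fderiv ℂ f u) = Module.finrank ℂ (FactorSpace V) - k := by
  have h1 := finrank_range_scalingTangent (ℓ := ℓ) hu
  rw [ker_fderiv_eq_range_scalingTangent hι hκ hf hp hhost] at h1
  have h2 := LinearMap.finrank_range_add_finrank_ker (fderiv ℂ f u : FactorSpace V →ₗ[ℂ] W)
  rw [mapRank]
  omega

end FactorMap

theorem theorem3 :
    ∃ α : ℝ, 0 < α ∧
    ∀ (σ : Type*) (k : ℕ) (V : Fin k → Type*)
      [∀ j, NormedAddCommGroup (V j)] [∀ j, InnerProductSpace ℂ (V j)]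
      [∀ j, FiniteDimensional ℂ (V j)]
      (W : Type*) [NormedAddCommGroup W] [InnerProductSpace ℂ W] [FiniteDimensional ℂ W]
      (ι : ∀ j, V j →ₗ[ℂ] MvPolynomial σ ℂ) (_hι : ∀ j, Function.Injective (ι j))
      (κ : W →ₗ[ℂ] MvPolynomial σ ℂ) (hκ : Function.Injective κ)
      (ℓ : Fin k → ℕ)
      (hW : ∀ u : FactorSpace V, factorProduct ι ℓ u ∈ LinearMap.range κ)
      (p : W) (uhat : FactorSpace V)
      (_hp : IsIrreducibleFactorization ι ℓ uhat (κ p))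
      (_hhost : ∀ j, IsProperHost (ι j) (uhat.snd j))
      (r : ℕ) (_hr : r = Module.finrank ℂ (FactorSpace V) - k),
      ∃ δ > 0, ∃ ε > 0, ∃ C > 0, ∃ M > 0,
        ∀ ptilde : W, ‖ptilde - p‖ < ε → ∀ u₀ : FactorSpace V, ‖u₀ - uhat‖ < δ →
          (∀ j, ∃! B, IsRankProjection r
            (fderiv ℂ (fun u => facMap ι ℓ κ hκ hW u ptilde)
              (rankNewton r (fun u => facMap ι ℓ κ hκ hW u ptilde) u₀ j)) B) ∧
          ∃ utilde : FactorSpace V,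
            Filter.Tendsto (rankNewton r (fun u => facMap ι ℓ κ hκ hW u ptilde) u₀)
              Filter.atTop (nhds utilde) ∧
            (∃ ucheck ∈ factorArrays ℓ uhat,
              ‖utilde - ucheck‖ ≤
                α * ‖moorePenrose (rankProjection r
                    (fderiv ℂ (fun u => facMap ι ℓ κ hκ hW u p) uhat))‖ * ‖ptilde - p‖
                  + C * ‖ptilde - p‖ ^ 2) ∧
            (ptilde = p → ∀ j,
              ‖rankNewton r (fun u => facMap ι ℓ κ hκ hW u ptilde) u₀ (j + 1) - utilde‖ ≤
                M * ‖rankNewton r (fun u => facMap ι ℓ κ hκ hW u ptilde) u₀ j - utilde‖ ^ 2) := by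
  refine ⟨2, two_pos, ?_⟩
  intro σ k V _ _ _ W _ _ _ ι hι κ hκ ℓ hW p uhat hp hhost r hr
  let f : FactorSpace V → W := fun u => (LinearEquiv.ofInjective κ hκ).symm ⟨factorProduct ι ℓ u, hW u⟩
  have hf : ∀ u, κ (f u) = factorProduct ι ℓ u := fun u =>
    congrArg Subtype.val ((LinearEquiv.ofInjective κ hκ).apply_symm_apply ⟨factorProduct ι ℓ u, hW u⟩)
  have hne : ∀ j, uhat.snd j ≠ 0 := fun j h => by
    refine (hp.irreducible j).ne_zero ?_
    rw [h, map_zero]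
  have h0 := scalingOrbit_zero ℓ uhat
  have hfg : ∀ s, f (scalingOrbit ℓ uhat s) = p := fun s => hκ (by
    rw [hf, factorProduct_scalingOrbit, hp.eq_prod])
  have hnear : ∀ᶠ u in nhds uhat, ∀ j, u.snd j ≠ 0 := by
    rw [Filter.eventually_all]
    intro j
    have hcont : Continuous fun u : FactorSpace V => u.snd j :=
      (PiLp.proj 2 V j ∘L WithLp.sndL 2 ℂ ℂ (PiLp 2 V)).continuous
    exact hcont.continuousAt.eventually_ne (hne j)
  have hmain := rankNewton_convergence (hasStrictFDerivAt_scalingOrbit ℓ uhat)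
    (contDiff_of_map_eq_factorProduct hκ hf) hfg (r := r)
    (by rw [h0]; exact ker_fderiv_eq_range_scalingTangent hι hκ hf hp hhost)
    (by rw [h0, hr]; exact mapRank_fderiv_eq hι hκ hf hp hhost hne)
    (by
      rw [h0, hr]
      exact hnear.mono fun u hu => mapRank_fderiv_le hκ hf hu)
  rw [h0] at hmain
  obtain ⟨δ, hδ, ε, hε, C, hC, M, hM, hconv⟩ := hmain
  refine ⟨δ, hδ, ε, hε, C, hC, M, hM, fun q hq u₀ hu₀ => ?_⟩
  obtain ⟨hproj, w, hw, ⟨s, hs⟩, hquad⟩ := hconv q hq u₀ hu₀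
  exact ⟨hproj, w, hw, ⟨_, scalingOrbit_mem_factorArrays ℓ uhat s, hs⟩, hquad⟩
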